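/- Let $q\ge 2$ and let $\Sigma_q=\{0,1,\dots,q-1\}$. A burst of $b$ deletions removes $b$ consecutive symbols from a word; a burst of $b$ insertions inserts $b$ consecutive arbitrary symbols of $\Sigma_q$ at one place of a word (possibly at an end). For $n\ge b+1$ and $\mathbf{x}\in\Sigma_q^n$ let $\mathcal{L}_1^b(\mathbf{x})\subseteq\Sigma_q^n$ be the fixed-length $b$-burst Levenshtein ball of radius one, that is, the set of all words of length $n$ that can be obtained from $\mathbf{x}$ by one burst of $b$ deletions followed by one burst of $b$ insertions. For all integers $b\ge 1$ and $q\ge 2$ there are a constant $C>0$ and an integer $N$, depending only on $b$ and $q$, such that for every $n\ge N$, if $\mathbf{x}$ is chosen uniformly at random from $\Sigma_q^n$, then $$\mathbb{P}\Big(\Big|\,|\mathcal{L}_1^b(\mathbf{x})|-\mathbb{E}_{\mathbf{y}\in\Sigma_q^n}\big[|\mathcal{L}_1^b(\mathbf{y})|\big]\Big|>C\sqrt{n^3\log_q n}\Big)\le\frac{3}{n},$$ where the expectation is over $\mathbf{y}$ uniform in $\Sigma_q^n$. -/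

import Mathlib

open MeasureTheory ProbabilityTheory

namespace BurstLevenshtein

/-- `y` is obtained from `x` by one burst of `b` deletions: `b` consecutive symbols of `x` are
removed. -/
def IsBurstDeletion {α : Type*} (b : ℕ) (x y : List α) : Prop :=
  ∃ u v w : List α, v.length = b ∧ x = u ++ v ++ w ∧ y = u ++ w

/-- `y` is obtained from `x` by one burst of `b` insertions: `b` consecutive symbols are inserted
into `x` at one place (possibly at either end). -/
def IsBurstInsertion {α : Type*} (b : ℕ) (x y : List α) : Prop :=
  ∃ u v w : List α, v.length = b ∧ x = u ++ w ∧ y = u ++ v ++ w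

/-- The `b`-burst-deletion ball of radius `t`: the sequences obtained from `x` after exactly `t`
bursts of `b` deletions. -/
def deletionBall {α : Type*} (b : ℕ) : ℕ → List α → Set (List α)
  | 0, x => {x}
  | t + 1, x => {z | ∃ y ∈ deletionBall b t x, IsBurstDeletion b y z}

/-- The `b`-burst-insertion ball of radius `t`: the sequences obtained from `x` after exactly `t`
bursts of `b` insertions. -/
def insertionBall {α : Type*} (b : ℕ) : ℕ → List α → Set (List α)
  | 0, x => {x}
  | t + 1, x => {z | ∃ y ∈ insertionBall b t x, IsBurstInsertion b y z}

/-- The fixed-length `b`-burst Levenshtein ball of radius `t` centred at the word `x` of length `n`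
over the alphabet `{0, …, q - 1}`: the words of length `n` obtained from `x` by `t` bursts of `b`
deletions followed by `t` bursts of `b` insertions. -/
def levenshteinBall {n q : ℕ} (b t : ℕ) (x : Fin n → Fin q) : Set (Fin n → Fin q) :=
  {z | ∃ y ∈ deletionBall b t (List.ofFn x), List.ofFn z ∈ insertionBall b t y}

/-- The size of the fixed-length `b`-burst Levenshtein ball of radius one, as a real number. -/
noncomputable def ballSize {n q : ℕ} (b : ℕ) (x : Fin n → Fin q) : ℝ :=
  ((levenshteinBall b 1 x).ncard : ℝ)

/-- The uniform distribution on the words of length `n` over the alphabet `{0, …, q - 1}`. -/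
noncomputable def uniformWord (n q : ℕ) : Measure (Fin n → Fin q) :=
  uniformOn Set.univ

end BurstLevenshtein

namespace BurstLevenshtein

/-! A word of the ball differs from `x` by a shift, in one of two directions. Shrinking the modified
window either reduces the shift to the replacement of one block of `b` letters, or makes both ends
of the window genuine disagreements; in the latter case the pair `i < j` is determined by the two
words. For fixed `i < j` there are `(q - 1) * q ^ (b - 1)` reduced shifts or none, according to one
comparison of letters of `x` at distance `b`. Summing over pairs gives the main term, a multiple of
`changes b x` (`sum_card_reducedShift`).

The error has two sources: block replacements, and words reached in both directions. The latter
force a run of period `2 * b` in `x`, so without a run of length `ℓ` only `n * (b + ℓ)` pairs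
matter. For `ℓ` about `2 * logb q n` such a run has probability at most `1 / n`, and the error is of
order `n * logb q n`, both for the ball and for its mean.

Comparisons at distance `b` behave as independent trials (`integral_prod_letter`), so a Chernoff
bound controls `changes` outside an event of probability `2 / n`. -/

/-- The letter of the word `x` at position `k`, or `none` if `x` has no such position. -/
def letter {α : Type*} {n : ℕ} (x : Fin n → α) (k : ℕ) : Option α :=
  if h : k < n then some (x ⟨k, h⟩) else none

lemma letter_of_lt {α : Type*} {n : ℕ} (x : Fin n → α) {k : ℕ} (h : k < n) :
    letter x k = some (x ⟨k, h⟩) := dif_pos h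

lemma letter_of_le {α : Type*} {n : ℕ} (x : Fin n → α) {k : ℕ} (h : n ≤ k) :
    letter x k = none := dif_neg (by omega)

lemma letter_fin {α : Type*} {n : ℕ} (x : Fin n → α) (k : Fin n) :
    letter x k = some (x k) := letter_of_lt x k.2

lemma getElem?_ofFn_eq_letter {α : Type*} {n : ℕ} (x : Fin n → α) (k : ℕ) :
    (List.ofFn x)[k]? = letter x k := by
  simp [letter, List.getElem?_ofFn]

/-! ### The ball described by shifts -/

/-- `z` arises from `x` by deleting `b` letters at position `i` and inserting `b` letters at
position `j` (meaningful for `i ≤ j`). -/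
def IsShift {α : Type*} (b i j : ℕ) (x z : ℕ → α) : Prop :=
  (∀ k < i, z k = x k) ∧ (∀ k, i ≤ k → k < j → z k = x (k + b)) ∧
    ∀ k, j + b ≤ k → z k = x k

/-- A shift in which the modified positions range exactly from `i` to `j + b - 1`. -/
def IsReducedShift {α : Type*} (b i j : ℕ) (x z : ℕ → α) : Prop :=
  IsShift b i j x z ∧ z i ≠ x i ∧ z (j + b - 1) ≠ x (j + b - 1)

lemma getElem?_take_append_drop {α : Type*} {b : ℕ} {u v w : List α} (hv : v.length = b) (k : ℕ) :
    (u ++ w)[k]? = if k < u.length then (u ++ v ++ w)[k]? else (u ++ v ++ w)[k + b]? := by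
  subst hv
  split_ifs with h
  · rw [List.append_assoc, List.getElem?_append_left h, List.getElem?_append_left h]
  · rw [List.getElem?_append_right (by omega), List.getElem?_append_right (by simp; omega)]
    congr 1
    simp; omega

lemma mem_levenshteinBall_one_iff_eq {n q b : ℕ} {x z : Fin n → Fin q} :
    z ∈ levenshteinBall b 1 x ↔ ∃ i j, i + b ≤ n ∧ j + b ≤ n ∧
      ∀ k, (if k < i then letter x k else letter x (k + b)) =
        if k < j then letter z k else letter z (k + b) := by
  simp only [levenshteinBall, deletionBall, insertionBall, Set.mem_singleton_iff,
    Set.mem_ofPred_eq, exists_eq_left, IsBurstDeletion, IsBurstInsertion]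
  constructor
  · rintro ⟨y, ⟨u, v, w, hv, hx, hy⟩, u', v', w', hv', hy', hz⟩
    refine ⟨u.length, u'.length, ?_, ?_, fun k => ?_⟩
    · have := congrArg List.length hx
      simp at this; omega
    · have := congrArg List.length hz
      simp at this; omega
    · simp only [← getElem?_ofFn_eq_letter]
      rw [hx, hz, ← getElem?_take_append_drop hv, ← getElem?_take_append_drop hv', ← hy, ← hy']
  · rintro ⟨i, j, hi, hj, h⟩
    have key : ∀ (i : ℕ) (l : List (Fin q)), i + b ≤ l.length →
        ((l.drop i).take b).length = b ∧ l = l.take i ++ (l.drop i).take b ++ l.drop (i + b) ∧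
        (l.take i).length = i := by
      intro i l hl
      refine ⟨by simp; omega, ?_, by simp; omega⟩
      rw [List.append_assoc, ← List.drop_drop, List.take_append_drop, List.take_append_drop]
    obtain ⟨h1, h2, h3⟩ := key i (List.ofFn x) (by simpa using hi)
    obtain ⟨h4, h5, h6⟩ := key j (List.ofFn z) (by simpa using hj)
    refine ⟨_, ⟨_, _, _, h1, h2, rfl⟩, _, _, _, h4, ?_, h5⟩
    apply List.ext_getElem?
    intro k
    have e1 := getElem?_take_append_drop (u := (List.ofFn x).take i)
      (w := (List.ofFn x).drop (i + b)) h1 k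
    have e2 := getElem?_take_append_drop (u := (List.ofFn z).take j)
      (w := (List.ofFn z).drop (j + b)) h4 k
    rw [← h2, h3] at e1
    rw [← h5, h6] at e2
    rw [e1, e2]
    simpa only [getElem?_ofFn_eq_letter] using h k

lemma isShift_iff {α : Type*} {b i j : ℕ} (hij : i ≤ j) {x z : ℕ → α} :
    IsShift b i j x z ↔ ∀ k, (if k < i then x k else x (k + b)) =
        if k < j then z k else z (k + b) := by
  constructor
  · rintro ⟨h1, h2, h3⟩ k
    split_ifs with ha hb hb
    · exact (h1 k ha).symm
    · omega
    · exact (h2 k (by omega) hb).symm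
    · exact (h3 _ (by omega)).symm
  · intro h
    refine ⟨fun k hk => ?_, fun k hk hk' => ?_, fun k hk => ?_⟩
    · simpa [hk, show k < j by omega, eq_comm] using h k
    · simpa [hk', show ¬ k < i by omega, eq_comm] using h k
    · obtain ⟨k, rfl⟩ : ∃ k', k = k' + b := ⟨k - b, by omega⟩
      simpa [show ¬ k < i by omega, show ¬ k < j by omega, eq_comm] using h k

lemma mem_levenshteinBall_one_iff {n q b : ℕ} {x z : Fin n → Fin q} :
    z ∈ levenshteinBall b 1 x ↔ ∃ i j, i ≤ j ∧ j + b ≤ n ∧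
      (IsShift b i j (letter x) (letter z) ∨ IsShift b i j (letter z) (letter x)) := by
  rw [mem_levenshteinBall_one_iff_eq]
  constructor
  · rintro ⟨i, j, hi, hj, h⟩
    rcases le_total i j with hij | hij
    · exact ⟨i, j, hij, hj, Or.inl ((isShift_iff hij).2 h)⟩
    · exact ⟨j, i, hij, hi, Or.inr ((isShift_iff hij).2 fun k => (h k).symm)⟩
  · rintro ⟨i, j, hij, hj, h | h⟩
    · exact ⟨i, j, by omega, hj, (isShift_iff hij).1 h⟩
    · exact ⟨j, i, hj, by omega, fun k => ((isShift_iff hij).1 h k).symm⟩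

/-! ### Reduced shifts: existence, uniqueness, overlap of the two directions -/

/-- An end of the window where the words agree can be moved inwards, keeping the shift; this stops
at genuine disagreements or at `i = j`. -/
lemma IsShift.exists_reduced {α : Type*} {b m : ℕ} {x z : ℕ → α} {i j : ℕ}
    (hij : i ≤ j) (hj : j ≤ m) (h : IsShift b i j x z) :
    (∃ i ≤ m, IsShift b i i x z) ∨ ∃ i j, i < j ∧ j ≤ m ∧ IsReducedShift b i j x z := by
  obtain ⟨d, rfl⟩ := Nat.exists_eq_add_of_le hij
  induction d generalizing i with
  | zero => exact Or.inl ⟨i, hj, h⟩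
  | succ d ih =>
    by_cases h1 : z i = x i
    · refine ih (i := i + 1) (by omega) (by omega) ⟨fun k hk => ?_, fun k hk hk' => ?_,
        fun k hk => ?_⟩
      · rcases Nat.lt_succ_iff_lt_or_eq.1 hk with hk | rfl
        · exact h.1 k hk
        · exact h1
      · exact h.2.1 k (by omega) (by omega)
      · exact h.2.2 k (by omega)
    by_cases h2 : z (i + (d + 1) + b - 1) = x (i + (d + 1) + b - 1)
    · refine ih (i := i) (by omega) (by omega) ⟨h.1, fun k hk hk' => ?_, fun k hk => ?_⟩
      · exact h.2.1 k (by omega) (by omega)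
      · rcases Nat.eq_or_lt_of_le hk with hk | hk
        · rw [← hk]; convert h2 using 2 <;> omega
        · exact h.2.2 k (by omega)
    exact Or.inr ⟨i, i + (d + 1), by omega, hj, h, h1, h2⟩

/-- Two words that differ at the ends of two windows, and agree outside of each, differ in one and
the same window. -/
lemma window_unique {α : Type*} {x z : ℕ → α} {i j i' j' : ℕ}
    (h1 : ∀ k < i, z k = x k) (h2 : ∀ k, j < k → z k = x k) (hi : z i ≠ x i) (hj : z j ≠ x j)
    (h1' : ∀ k < i', z k = x k) (h2' : ∀ k, j' < k → z k = x k) (hi' : z i' ≠ x i')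
    (hj' : z j' ≠ x j') : i = i' ∧ j = j' := by
  constructor
  · rcases lt_trichotomy i i' with h | h | h
    · exact absurd (h1' _ h) hi
    · exact h
    · exact absurd (h1 _ h) hi'
  · rcases lt_trichotomy j j' with h | h | h
    · exact absurd (h2 _ h) hj'
    · exact h
    · exact absurd (h2' _ h) hj

lemma IsReducedShift.unique {α : Type*} {b i j i' j' : ℕ} (hb : 1 ≤ b) {x z : ℕ → α}
    (h : IsReducedShift b i j x z) (h' : IsReducedShift b i' j' x z) : i = i' ∧ j = j' := by
  have := window_unique h.1.1 (fun k hk => h.1.2.2 k (by omega)) h.2.1 h.2.2 h'.1.1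
    (fun k hk => h'.1.2.2 k (by omega)) h'.2.1 h'.2.2
  omega

lemma IsReducedShift.unique_swap {α : Type*} {b i j i' j' : ℕ} (hb : 1 ≤ b) {x z : ℕ → α}
    (h : IsReducedShift b i j x z) (h' : IsReducedShift b i' j' z x) : i = i' ∧ j = j' := by
  have := window_unique h.1.1 (fun k hk => h.1.2.2 k (by omega)) h.2.1 h.2.2
    (fun k hk => (h'.1.1 k hk).symm)
    (fun k hk => (h'.1.2.2 k (by omega)).symm) h'.2.1.symm h'.2.2.symm
  omega

/-- A word with two letters at distance `d` equal at `ℓ` consecutive places. -/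
def HasPeriodicRun {α : Type*} {n : ℕ} (d ℓ : ℕ) (x : Fin n → α) : Prop :=
  ∃ s, s + ℓ + d ≤ n ∧ ∀ k < ℓ, letter x (s + k) = letter x (s + k + d)

/-- Going from `x` to `z` and back moves the index by `b` twice, whence the period `2 * b`. -/
lemma IsShift.hasPeriodicRun {α : Type*} {n b ℓ i j : ℕ} {x z : Fin n → α}
    (h : IsShift b i j (letter x) (letter z)) (h' : IsShift b i j (letter z) (letter x))
    (hj : j + b ≤ n) (hl : i + b + ℓ ≤ j) : HasPeriodicRun (2 * b) ℓ x := by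
  refine ⟨i, by omega, fun k hk => ?_⟩
  rw [h'.2.1 (i + k) (by omega) (by omega), h.2.1 (i + k + b) (by omega) (by omega)]
  congr 1; omega

/-! ### Counting the shifts for a given pair -/

/-- Number of words with free letters in a window, one of them avoiding a given value. -/
lemma card_window_avoid {α : Type*} [Fintype α] [DecidableEq α] {n b s : ℕ} (hs : s + b ≤ n)
    (y : Fin n → α) (r : Fin n) (hr : s ≤ r) (hr' : (r : ℕ) < s + b) (a : α)
    (T : Finset (Fin n → α))
    (hT : ∀ z, z ∈ T ↔ (∀ k : Fin n, ((k : ℕ) < s ∨ s + b ≤ k) → z k = y k) ∧ z r ≠ a) :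
    T.card = (Fintype.card α - 1) * Fintype.card α ^ (b - 1) := by
  -- The set is a box: the count is a product over coordinates, with a factor one off the window.
  have hTe : T = Fintype.piFinset (fun k : Fin n => if k = r then Finset.univ.erase a else
      if (k : ℕ) < s ∨ s + b ≤ k then {y k} else Finset.univ) := by
    ext z
    rw [hT, Fintype.mem_piFinset]
    constructor
    · rintro ⟨h1, h2⟩ k
      split_ifs with h3 h4
      · subst h3; simpa using h2
      · simpa using h1 k h4
      · simp
    · intro h
      refine ⟨fun k hk => ?_, ?_⟩
      · have := h k
        rw [if_neg (by rintro rfl; omega), if_pos hk] at this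
        simpa using this
      · simpa using h r
  rw [hTe, Fintype.card_piFinset, ← Finset.mul_prod_erase _ _ (Finset.mem_univ r)]
  congr 1
  · simp [Finset.card_erase_of_mem]
  · rw [← Finset.prod_subset (s₁ := (Finset.univ.filter
      (fun k : Fin n => s ≤ k ∧ (k : ℕ) < s + b)).erase r)
      (Finset.erase_subset_erase _ (Finset.subset_univ _))]
    · rw [Finset.prod_congr rfl (g := fun _ => Fintype.card α), Finset.prod_const]
      · congr 1
        rw [Finset.card_erase_of_mem (by simp; omega)]
        congr 1
        rw [← Finset.card_map Fin.valEmbedding,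
          show (Finset.map Fin.valEmbedding (Finset.univ.filter
            (fun k : Fin n => s ≤ k ∧ (k : ℕ) < s + b))) = Finset.Ico s (s + b) from ?_]
        · simp
        · ext k
          simp only [Finset.mem_map, Finset.mem_filter, Finset.mem_univ, true_and,
            Fin.valEmbedding_apply, Finset.mem_Ico]
          constructor
          · rintro ⟨k, hk, rfl⟩; exact hk
          · intro hk; exact ⟨⟨k, by omega⟩, hk, rfl⟩
      · intro k hk
        simp only [Finset.mem_erase, Finset.mem_filter, Finset.mem_univ, true_and] at hk
        rw [if_neg hk.1, if_neg (by omega)]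
        simp
    · intro k hk hk'
      simp only [Finset.mem_erase, Finset.mem_filter, Finset.mem_univ, true_and, and_true] at hk hk'
      rw [if_neg hk, if_pos (by by_contra hc; exact hk' ⟨hk, by omega⟩)]
      simp

open Classical in
lemma card_window_le {α : Type*} [Fintype α] {n b s : ℕ} (hs : s + b ≤ n) (x : Fin n → α) :
    (Finset.univ.filter (fun z : Fin n → α => IsShift b s s (letter x) (letter z))).card ≤
      Fintype.card α ^ b := by
  have : Fintype.card α ^ b = Fintype.card (Fin b → α) := by simp
  rw [this, ← Finset.card_univ]
  refine Finset.card_le_card_of_injOn (fun z k => z ⟨s + k, by omega⟩) (fun _ _ => by simp) ?_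
  intro z hz z' hz' h
  simp only [Finset.coe_filter, Finset.mem_univ, true_and, Set.mem_ofPred_eq] at hz hz'
  ext k
  by_cases hk : s ≤ k ∧ (k : ℕ) < s + b
  · have := congrFun h ⟨k - s, by omega⟩
    simpa [show s + (k - s : ℕ) = k by omega] using this
  · have : letter z k = letter z' k := by
      rcases Nat.lt_or_ge k s with hks | hks
      · rw [hz.1 _ hks, hz'.1 _ hks]
      · rw [hz.2.2 k (by omega), hz'.2.2 k (by omega)]
    simpa [letter_fin] using this

open Classical in
-- Only the block of `z` at `j` is free, and its last letter must avoid that of `x`. Since `i < j`,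
-- the letter of `z` at `i` is that of `x` at `i + b`, so disagreement at `i` is a condition on `x`
-- alone.
lemma card_reducedShift {α : Type*} [Fintype α] {n b i j : ℕ} (hb : 1 ≤ b) (hij : i < j)
    (hj : j + b ≤ n) (x : Fin n → α) :
    (Finset.univ.filter (fun z : Fin n → α => IsReducedShift b i j (letter x) (letter z))).card =
      if letter x i ≠ letter x (i + b) then
        (Fintype.card α - 1) * Fintype.card α ^ (b - 1) else 0 := by
  split_ifs with h
  · refine card_window_avoid (s := j) hj
      (fun k => if hk : i ≤ k ∧ (k : ℕ) < j then x ⟨k + b, by omega⟩ else x k)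
      ⟨j + b - 1, by omega⟩ (by simp; omega) (by simp; omega) (x ⟨j + b - 1, by omega⟩) _
      (fun z => ?_)
    simp only [Finset.mem_filter, Finset.mem_univ, true_and]
    have hlast : letter z (j + b - 1) ≠ letter x (j + b - 1) ↔
        z ⟨j + b - 1, by omega⟩ ≠ x ⟨j + b - 1, by omega⟩ := by
      rw [letter_of_lt z (by omega), letter_of_lt x (by omega)]; simp
    constructor
    · rintro ⟨⟨h1, h2, h3⟩, -, h5⟩
      refine ⟨fun k hk => ?_, hlast.1 h5⟩
      apply Option.some_injective
      rw [← letter_fin]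
      split_ifs with hk'
      · rw [h2 k hk'.1 hk'.2, letter_of_lt]
      · rw [← letter_fin]
        rcases Nat.lt_or_ge k i with hki | hki
        · exact h1 _ hki
        · exact h3 _ (by omega)
    · rintro ⟨h1, h2⟩
      have h1' : ∀ k, (hk : k < n) → (k < j ∨ j + b ≤ k) → letter z k =
          if i ≤ k ∧ k < j then letter x (k + b) else letter x k := by
        intro k hk hk'
        rw [letter_of_lt z hk, h1 ⟨k, hk⟩ hk']
        split_ifs with hc
        · rw [letter_of_lt]
        · rw [letter_of_lt]
      refine ⟨⟨fun k hk => ?_, fun k hk hk' => ?_, fun k hk => ?_⟩, ?_, hlast.2 h2⟩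
      · rw [h1' k (by omega) (by omega), if_neg (by omega)]
      · rw [h1' k (by omega) (by omega), if_pos (by omega)]
      · rcases Nat.lt_or_ge k n with hkn | hkn
        · rw [h1' k (by omega) (by omega), if_neg (by omega)]
        · rw [letter_of_le _ hkn, letter_of_le _ hkn]
      · rw [h1' i (by omega) (by omega), if_pos (by omega)]
        exact h.symm
  · push Not at h
    rw [Finset.card_eq_zero, Finset.filter_eq_empty_iff]
    rintro z - ⟨⟨-, h2, -⟩, h4, -⟩
    exact h4 (by rw [h2 i le_rfl hij, h])

open Classical in
-- Here the free block of `z` sits at `i`, and it is the disagreement at the right end that becomes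
-- a condition on `x`.
lemma card_reducedShift_swap {α : Type*} [Fintype α] {n b i j : ℕ} (hb : 1 ≤ b) (hij : i < j)
    (hj : j + b ≤ n) (x : Fin n → α) :
    (Finset.univ.filter (fun z : Fin n → α => IsReducedShift b i j (letter z) (letter x))).card =
      if letter x (j - 1) ≠ letter x (j - 1 + b) then
        (Fintype.card α - 1) * Fintype.card α ^ (b - 1) else 0 := by
  split_ifs with h
  · refine card_window_avoid (s := i) (by omega)
      (fun k => if hk : i + b ≤ k ∧ (k : ℕ) < j + b then x ⟨k - b, by omega⟩ else x k)
      ⟨i, by omega⟩ (by simp) (by simp; omega) (x ⟨i, by omega⟩) _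
      (fun z => ?_)
    simp only [Finset.mem_filter, Finset.mem_univ, true_and]
    have hfirst : letter x i ≠ letter z i ↔ z ⟨i, by omega⟩ ≠ x ⟨i, by omega⟩ := by
      rw [letter_of_lt z (by omega), letter_of_lt x (by omega)]; simp [eq_comm]
    constructor
    · rintro ⟨⟨h1, h2, h3⟩, h5, -⟩
      refine ⟨fun k hk => ?_, hfirst.1 h5⟩
      apply Option.some_injective
      rw [← letter_fin]
      split_ifs with hk'
      · have := h2 (k - b) (by omega) (by omega)
        rw [show (k : ℕ) - b + b = k by omega] at this
        rw [← this, letter_of_lt]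
      · rw [← letter_fin]
        rcases Nat.lt_or_ge k i with hki | hki
        · exact (h1 _ hki).symm
        · exact (h3 _ (by omega)).symm
    · rintro ⟨h1, h2⟩
      have h1' : ∀ k, (hk : k < n) → (k < i ∨ i + b ≤ k) → letter z k =
          if i + b ≤ k ∧ k < j + b then letter x (k - b) else letter x k := by
        intro k hk hk'
        rw [letter_of_lt z hk, h1 ⟨k, hk⟩ hk']
        split_ifs with hc
        · rw [letter_of_lt]
        · rw [letter_of_lt]
      refine ⟨⟨fun k hk => ?_, fun k hk hk' => ?_, fun k hk => ?_⟩, hfirst.2 h2, ?_⟩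
      · rw [h1' k (by omega) (by omega), if_neg (by omega)]
      · rw [h1' (k + b) (by omega) (by omega), if_pos (by omega), Nat.add_sub_cancel]
      · rcases Nat.lt_or_ge k n with hkn | hkn
        · rw [h1' k (by omega) (by omega), if_neg (by omega)]
        · rw [letter_of_le _ hkn, letter_of_le _ hkn]
      · rw [h1' (j + b - 1) (by omega) (by omega), if_pos (by omega),
          show j + b - 1 = j - 1 + b by omega, Nat.add_sub_cancel]
        exact h.symm
  · push Not at h
    rw [Finset.card_eq_zero, Finset.filter_eq_empty_iff]
    rintro z - ⟨⟨-, h2, -⟩, -, h4⟩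
    have := h2 (j - 1) (by omega) (by omega)
    rw [show j + b - 1 = j - 1 + b by omega] at h4
    exact h4 (by rw [← this, h])

/-! ### The size of the ball in terms of `changes` -/

open Classical in
/-- The number of positions `i` at which `x` carries another letter than at `i + b`. -/
noncomputable def changes {α : Type*} {n : ℕ} (b : ℕ) (x : Fin n → α) : ℕ :=
  ∑ i ∈ Finset.range (n - b), if letter x i ≠ letter x (i + b) then 1 else 0

/-- The pairs `i < j ≤ m`, listed as `⟨j, i⟩`. -/
def pairs (m : ℕ) : Finset (Σ _ : ℕ, ℕ) := (Finset.range (m + 1)).sigma Finset.range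

lemma mem_pairs {m : ℕ} {p : Σ _ : ℕ, ℕ} : p ∈ pairs m ↔ p.2 < p.1 ∧ p.1 ≤ m := by
  simp [pairs]; omega

/-- An index `k < m` is the lower entry of `m - k` pairs and precedes the upper entry of `k + 1`
pairs, hence the uniform weight `m + 1`. -/
lemma sum_pairs (D : ℕ → ℕ) (m : ℕ) :
    ∑ p ∈ pairs m, (D p.2 + D (p.1 - 1)) = (m + 1) * ∑ i ∈ Finset.range m, D i := by
  rw [pairs, Finset.sum_sigma]
  induction m with
  | zero => simp
  | succ m ih =>
    rw [Finset.sum_range_succ, ih, Finset.sum_add_distrib, Finset.sum_range_succ D m]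
    simp
    ring

open Classical in
lemma sum_card_reducedShift {α : Type*} [Fintype α] {n b : ℕ} (hb : 1 ≤ b) (hn : b ≤ n)
    (x : Fin n → α) :
    ∑ p ∈ pairs (n - b), (Finset.univ.filter
        (fun z : Fin n → α => IsReducedShift b p.2 p.1 (letter x) (letter z))).card +
      ∑ p ∈ pairs (n - b), (Finset.univ.filter
        (fun z : Fin n → α => IsReducedShift b p.2 p.1 (letter z) (letter x))).card =
    (Fintype.card α - 1) * Fintype.card α ^ (b - 1) * ((n - b + 1) * changes b x) := by
  rw [changes, ← sum_pairs, Finset.mul_sum, ← Finset.sum_add_distrib]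
  refine Finset.sum_congr rfl fun p hp => ?_
  rw [mem_pairs] at hp
  rw [card_reducedShift hb hp.1 (by omega), card_reducedShift_swap hb hp.1 (by omega)]
  split_ifs <;> ring

open Classical in
lemma ncard_levenshteinBall_le {n q b : ℕ} (hb : 1 ≤ b) (hn : b ≤ n) (x : Fin n → Fin q) :
    (levenshteinBall b 1 x).ncard ≤
      (q - 1) * q ^ (b - 1) * ((n - b + 1) * changes b x) + n * q ^ b := by
  have h1 := sum_card_reducedShift hb hn x
  rw [Fintype.card_fin] at h1
  rw [← h1, Set.ncard_eq_toFinset_card']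
  have hsub : (levenshteinBall b 1 x).toFinset ⊆
      (((pairs (n - b)).biUnion fun p => Finset.univ.filter
        (fun z : Fin n → Fin q => IsReducedShift b p.2 p.1 (letter x) (letter z))) ∪
      ((pairs (n - b)).biUnion fun p => Finset.univ.filter
        (fun z : Fin n → Fin q => IsReducedShift b p.2 p.1 (letter z) (letter x)))) ∪
      (Finset.range (n - b + 1)).biUnion fun i => Finset.univ.filter
        (fun z : Fin n → Fin q => IsShift b i i (letter x) (letter z)) := by
    intro z hz
    rw [Set.mem_toFinset, mem_levenshteinBall_one_iff] at hz
    simp only [Finset.mem_union, Finset.mem_biUnion, Finset.mem_filter, Finset.mem_univ, true_and,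
      Finset.mem_range, mem_pairs]
    obtain ⟨i, j, hij, hj, h | h⟩ := hz
    · rcases h.exists_reduced hij (m := n - b) (by omega) with ⟨i, hi, h⟩ | ⟨i, j, h1, h2, h3⟩
      · exact Or.inr ⟨i, by omega, h⟩
      · exact Or.inl (Or.inl ⟨⟨j, i⟩, ⟨h1, h2⟩, h3⟩)
    · rcases h.exists_reduced hij (m := n - b) (by omega) with ⟨i, hi, h⟩ | ⟨i, j, h1, h2, h3⟩
      · exact Or.inr ⟨i, by omega, fun k hk => (h.1 k hk).symm, fun k _ _ => by omega,
          fun k hk => (h.2.2 k hk).symm⟩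
      · exact Or.inl (Or.inr ⟨⟨j, i⟩, ⟨h1, h2⟩, h3⟩)
  refine (Finset.card_le_card hsub).trans ((Finset.card_union_le _ _).trans
    (add_le_add ((Finset.card_union_le _ _).trans
      (add_le_add Finset.card_biUnion_le Finset.card_biUnion_le)) ?_))
  refine (Finset.card_biUnion_le_card_mul _ _ (q ^ b) fun i hi => ?_).trans ?_
  · rw [Finset.mem_range] at hi
    simpa using card_window_le (b := b) (s := i) (by omega) x
  · rw [Finset.card_range]
    exact Nat.mul_le_mul_right _ (by omega)

open Classical in
-- Within one direction the counted sets are disjoint, so only words reached in both directions are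
-- counted twice. Their two pairs coincide, and without a run that pair satisfies `j < i + b + ℓ`.
lemma le_ncard_levenshteinBall {n q b ℓ : ℕ} (hb : 1 ≤ b) (hn : b ≤ n) (x : Fin n → Fin q)
    (hx : ¬ HasPeriodicRun (2 * b) ℓ x) :
    (q - 1) * q ^ (b - 1) * ((n - b + 1) * changes b x) ≤
      (levenshteinBall b 1 x).ncard + n * (b + ℓ) * q ^ b := by
  have h1 := sum_card_reducedShift hb hn x
  rw [Fintype.card_fin] at h1
  rw [← h1, Set.ncard_eq_toFinset_card']
  set A : (Σ _ : ℕ, ℕ) → Finset (Fin n → Fin q) := fun p => Finset.univ.filter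
        (fun z : Fin n → Fin q => IsReducedShift b p.2 p.1 (letter x) (letter z)) with hA
  set B : (Σ _ : ℕ, ℕ) → Finset (Fin n → Fin q) := fun p => Finset.univ.filter
        (fun z : Fin n → Fin q => IsReducedShift b p.2 p.1 (letter z) (letter x)) with hB
  have hAd : ((pairs (n - b)).biUnion A).card = ∑ p ∈ pairs (n - b), (A p).card := by
    refine Finset.card_biUnion fun p _ p' _ hpp => Finset.disjoint_left.2 fun z hz hz' => hpp ?_
    simp only [hA, Finset.mem_filter, Finset.mem_univ, true_and] at hz hz'
    obtain ⟨h2, h3⟩ := hz.unique hb hz'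
    cases p; cases p'; simp_all
  have hBd : ((pairs (n - b)).biUnion B).card = ∑ p ∈ pairs (n - b), (B p).card := by
    refine Finset.card_biUnion fun p _ p' _ hpp => Finset.disjoint_left.2 fun z hz hz' => hpp ?_
    simp only [hB, Finset.mem_filter, Finset.mem_univ, true_and] at hz hz'
    obtain ⟨h2, h3⟩ := window_unique (fun k hk => hz.1.1 k hk)
      (fun k (hk : p.1 + b - 1 < k) => hz.1.2.2 k (by omega)) hz.2.1 hz.2.2 hz'.1.1
      (fun k (hk : p'.1 + b - 1 < k) => hz'.1.2.2 k (by omega)) hz'.2.1 hz'.2.2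
    cases p; cases p'
    simp only [Sigma.mk.injEq, heq_eq_eq]
    exact ⟨by simp only at h3; omega, h2⟩
  rw [← hAd, ← hBd, ← Finset.card_union_add_card_inter]
  refine add_le_add (Finset.card_le_card ?_) ?_
  · intro z hz
    rw [Set.mem_toFinset, mem_levenshteinBall_one_iff]
    simp only [Finset.mem_union, Finset.mem_biUnion, hA, hB, Finset.mem_filter, Finset.mem_univ,
      true_and, mem_pairs] at hz
    rcases hz with ⟨p, hp, h⟩ | ⟨p, hp, h⟩
    · exact ⟨p.2, p.1, hp.1.le, by omega, Or.inl h.1⟩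
    · exact ⟨p.2, p.1, hp.1.le, by omega, Or.inr h.1⟩
  · set P := (pairs (n - b)).filter fun p => p.1 < p.2 + b + ℓ with hP
    have hPc : P.card ≤ n * (b + ℓ) := by
      rw [← Finset.card_range n, ← Finset.card_range (b + ℓ), ← Finset.card_product]
      refine Finset.card_le_card_of_injOn (fun p => (p.2, p.1 - p.2 - 1)) ?_ ?_
      · intro p hp
        simp only [hP, Finset.coe_filter, mem_pairs, Set.mem_ofPred_eq] at hp
        simp
        omega
      · rintro ⟨j, i⟩ hp ⟨j', i'⟩ hp' h
        simp only [hP, Finset.coe_filter, mem_pairs, Set.mem_ofPred_eq, Prod.mk.injEq] at hp hp' h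
        simp only [Sigma.mk.injEq, heq_eq_eq]
        omega
    have hsub : (pairs (n - b)).biUnion A ∩ (pairs (n - b)).biUnion B ⊆ P.biUnion A := by
      intro z hz
      simp only [Finset.mem_inter, Finset.mem_biUnion] at hz ⊢
      obtain ⟨⟨p, hp, h⟩, ⟨p', hp', h'⟩⟩ := hz
      refine ⟨p, ?_, h⟩
      simp only [hA, hB, Finset.mem_filter, Finset.mem_univ, true_and] at h h'
      obtain ⟨h2, h3⟩ := h.unique_swap hb h'
      rw [← h2, ← h3] at h'
      simp only [hP, Finset.mem_filter, hp, true_and]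
      rw [mem_pairs] at hp
      by_contra hc
      exact hx (h.1.hasPeriodicRun h'.1 (by omega) (by omega))
    refine (Finset.card_le_card hsub).trans
      ((Finset.card_biUnion_le_card_mul _ _ (q ^ b) fun p hp => ?_).trans
        (Nat.mul_le_mul_right _ hPc))
    simp only [hP, Finset.mem_filter, mem_pairs] at hp
    rw [hA, card_reducedShift hb hp.1.1 (by omega), Fintype.card_fin]
    split_ifs
    · calc (q - 1) * q ^ (b - 1) ≤ q * q ^ (b - 1) := Nat.mul_le_mul_right _ (Nat.sub_le _ _)
        _ = q ^ b := mul_pow_sub_one (by omega) q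
    · exact Nat.zero_le _

/-! ### Independence of letter comparisons and periodic runs -/

lemma letter_snoc_of_lt {α : Type*} {n : ℕ} (x : Fin n → α) (a : α) {k : ℕ} (h : k < n) :
    letter (Fin.snoc (α := fun _ => α) x a) k = letter x k := by
  rw [letter_of_lt x h, letter_of_lt _ (by omega)]
  exact congrArg some (Fin.snoc_castSucc (α := fun _ => α) a x ⟨k, h⟩)

lemma letter_snoc_self {α : Type*} {n : ℕ} (x : Fin n → α) (a : α) :
    letter (Fin.snoc (α := fun _ => α) x a) n = some a := by
  rw [letter_of_lt _ (by omega)]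
  exact congrArg some (Fin.snoc_last (α := fun _ => α) a x)

/-- An appended letter enters only the last factor, whose sum over that letter does not depend on
the letter it is compared with. Induction on the length then factorises the sum. -/
lemma sum_prod_letter {α : Type*} [Fintype α] {d : ℕ} (hd : 1 ≤ d)
    (φ : ℕ → Option α → Option α → ℝ) (M : ℕ → ℝ)
    (hφ : ∀ i c, ∑ a, φ i (some c) (some a) = Fintype.card α * M i) (n : ℕ) :
    ∑ x : Fin n → α, ∏ i ∈ Finset.range (n - d), φ i (letter x i) (letter x (i + d)) =
      (Fintype.card α : ℝ) ^ n * ∏ i ∈ Finset.range (n - d), M i := by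
  induction n with
  | zero => simp
  | succ n ih =>
    rw [← (Fin.snocEquiv (fun _ => α)).sum_comp, Fintype.sum_prod_type, Finset.sum_comm]
    simp only [Fin.snocEquiv, Equiv.coe_fn_mk]
    rcases Nat.lt_or_ge n d with h | h
    · simp only [show n + 1 - d = 0 by omega, Finset.range_zero, Finset.prod_empty]
      simp [pow_succ]
    · simp only [show n + 1 - d = n - d + 1 by omega, Finset.prod_range_succ]
      rw [pow_succ, mul_mul_mul_comm, ← ih, Finset.sum_mul]
      refine Finset.sum_congr rfl fun x _ => ?_
      rw [← hφ (n - d) (x ⟨n - d, by omega⟩), Finset.mul_sum]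
      refine Finset.sum_congr rfl fun a _ => ?_
      congr 1
      · refine Finset.prod_congr rfl fun i hi => ?_
        rw [Finset.mem_range] at hi
        rw [letter_snoc_of_lt x a (k := i) (by omega),
          letter_snoc_of_lt x a (k := i + d) (by omega)]
      · rw [letter_snoc_of_lt x a (k := n - d) (by omega), Nat.sub_add_cancel h,
          letter_snoc_self, letter_of_lt]

lemma isProbabilityMeasure_uniformWord (n : ℕ) {q : ℕ} (hq : 1 ≤ q) :
    IsProbabilityMeasure (uniformWord n q) :=
  isProbabilityMeasure_uniformOn Set.finite_univ ⟨fun _ => ⟨0, hq⟩, trivial⟩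

lemma integral_uniformWord {n q : ℕ} (f : (Fin n → Fin q) → ℝ) :
    ∫ x, f x ∂uniformWord n q = (∑ x, f x) / (q : ℝ) ^ n := by
  have hfin : IsFiniteMeasure (uniformWord n q) := by unfold uniformWord; infer_instance
  rw [integral_fintype .of_finite, Finset.sum_div]
  refine Finset.sum_congr rfl fun x _ => ?_
  have : (uniformWord n q).real {x} = 1 / (q : ℝ) ^ n := by
    rw [measureReal_def, uniformWord, uniformOn_univ, Measure.count_singleton]
    simp
  rw [this, smul_eq_mul]
  ring

lemma integral_prod_letter {n q d : ℕ} (hq : 1 ≤ q) (hd : 1 ≤ d)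
    (φ : ℕ → Option (Fin q) → Option (Fin q) → ℝ) (M : ℕ → ℝ)
    (hφ : ∀ i c, ∑ a, φ i (some c) (some a) = q * M i) :
    ∫ x, ∏ i ∈ Finset.range (n - d), φ i (letter x i) (letter x (i + d)) ∂uniformWord n q =
      ∏ i ∈ Finset.range (n - d), M i := by
  rw [integral_uniformWord, sum_prod_letter hd φ M (by simpa using hφ), Fintype.card_fin]
  have : (q : ℝ) ^ n ≠ 0 := by positivity
  field_simp

open Classical in
lemma measureReal_uniformWord {n q : ℕ} (hq : 1 ≤ q) (S : Set (Fin n → Fin q)) :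
    (uniformWord n q).real S = ∫ x, (if x ∈ S then 1 else 0) ∂uniformWord n q := by
  have := isProbabilityMeasure_uniformWord n hq
  rw [← integral_indicator_one (S.toFinite.measurableSet)]
  rfl

lemma measureReal_run {n q d s ℓ : ℕ} (hq : 1 ≤ q) (hd : 1 ≤ d) (hs : s + ℓ + d ≤ n) :
    (uniformWord n q).real {x | ∀ k < ℓ, letter x (s + k) = letter x (s + k + d)} =
      ((q : ℝ)⁻¹) ^ ℓ := by
  classical
  have hq0 : (q : ℝ) ≠ 0 := by positivity
  have h := integral_prod_letter (n := n) hq hd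
    (fun i u v => if i ∈ Finset.Ico s (s + ℓ) then (if u = v then 1 else 0) else 1)
    (fun i => if i ∈ Finset.Ico s (s + ℓ) then (q : ℝ)⁻¹ else 1) (by
      intro i c
      split_ifs
      · simp [hq0]
      · simp)
  have hsub : Finset.Ico s (s + ℓ) ⊆ Finset.range (n - d) := by
    intro i; simp; omega
  rw [Finset.prod_ite_mem, Finset.inter_eq_right.2 hsub, Finset.prod_const, Nat.card_Ico,
    Nat.add_sub_cancel_left] at h
  rw [measureReal_uniformWord hq, ← h]
  refine integral_congr_ae (Filter.Eventually.of_forall fun x => ?_)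
  simp only [Set.mem_ofPred_eq]
  rw [Finset.prod_ite_mem, Finset.inter_eq_right.2 hsub, Finset.prod_ite_zero]
  simp only [Finset.prod_const_one]
  congr 1
  apply propext
  constructor
  · intro h i hi
    rw [Finset.mem_Ico] at hi
    have := h (i - s) (by omega)
    rwa [Nat.add_sub_cancel' hi.1] at this
  · intro h k hk
    exact h (s + k) (by simp [hk])

lemma measureReal_hasPeriodicRun_le {n q d ℓ : ℕ} (hq : 1 ≤ q) (hd : 1 ≤ d) :
    (uniformWord n q).real {x | HasPeriodicRun d ℓ x} ≤ n * ((q : ℝ)⁻¹) ^ ℓ := by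
  have := isProbabilityMeasure_uniformWord n hq
  -- The length bound stays inside the set: if the word is too short, truncated subtraction still
  -- leaves `s = 0` in the range.
  have hsub : {x : Fin n → Fin q | HasPeriodicRun d ℓ x} ⊆ ⋃ s ∈ Finset.range (n - (d + ℓ) + 1),
      {x | s + ℓ + d ≤ n ∧ ∀ k < ℓ, letter x (s + k) = letter x (s + k + d)} := by
    rintro x ⟨s, hs, h⟩
    simp only [Set.mem_iUnion]
    exact ⟨s, by simp; omega, hs, h⟩
  refine (measureReal_mono hsub (measure_ne_top _ _)).trans
    ((measureReal_biUnion_finset_le _ _).trans ?_)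
  by_cases hn : ℓ + d ≤ n
  · refine (Finset.sum_le_card_nsmul _ _ (((q : ℝ)⁻¹) ^ ℓ) fun s hs => ?_).trans ?_
    · rw [Finset.mem_range] at hs
      rw [← measureReal_run (n := n) (s := s) hq hd (by omega)]
      exact measureReal_mono fun x hx => hx.2
    · rw [Finset.card_range, nsmul_eq_mul]
      gcongr
      omega
  · rw [Finset.sum_eq_zero]
    · positivity
    · intro s _
      rw [show {x : Fin n → Fin q | s + ℓ + d ≤ n ∧
        ∀ k < ℓ, letter x (s + k) = letter x (s + k + d)} = ∅ from ?_, measureReal_empty]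
      ext x
      simp
      omega

/-! ### Mean and concentration of `changes` -/

open Classical in
lemma sum_ite_ne_some {q : ℕ} (hq : 1 ≤ q) (c : Fin q) (u v : ℝ) :
    ∑ a, (if (some c : Option (Fin q)) ≠ some a then u else v) = (q - 1) * u + v := by
  simp only [ne_eq, Option.some.injEq, ite_not]
  rw [← Finset.add_sum_erase _ _ (Finset.mem_univ c), if_pos rfl,
    Finset.sum_congr rfl (g := fun _ => u)]
  · simp [Finset.card_erase_of_mem, Nat.cast_sub hq]; ring
  · intro a ha
    rw [if_neg (Ne.symm (Finset.ne_of_mem_erase ha))]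

lemma integral_changes {n q b : ℕ} (hq : 1 ≤ q) (hb : 1 ≤ b) :
    ∫ x, (changes b x : ℝ) ∂uniformWord n q = (n - b : ℕ) * (1 - (q : ℝ)⁻¹) := by
  classical
  have := isProbabilityMeasure_uniformWord n hq
  have hq0 : (q : ℝ) ≠ 0 := by positivity
  simp only [changes, Nat.cast_sum]
  rw [integral_finsetSum _ fun _ _ => .of_finite, Finset.sum_congr rfl
    (g := fun _ => 1 - (q : ℝ)⁻¹)]
  · rw [Finset.sum_const, Finset.card_range, nsmul_eq_mul]
  · intro j hj
    have h := integral_prod_letter (n := n) hq hb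
      (fun i u v => if i = j then (if u ≠ v then 1 else 0) else 1)
      (fun i => if i = j then 1 - (q : ℝ)⁻¹ else 1) (by
        intro i c
        split_ifs
        · rw [sum_ite_ne_some hq]; field_simp; ring
        · simp)
    rw [Finset.prod_ite_eq' _ _ (fun _ => 1 - (q : ℝ)⁻¹), if_pos hj] at h
    rw [← h]
    refine integral_congr_ae (Filter.Eventually.of_forall fun x => ?_)
    simp only
    rw [Finset.prod_ite_eq' _ _ (fun i => if letter x i ≠ letter x (i + b) then (1 : ℝ) else 0),
      if_pos hj]
    push_cast
    rfl

/-- Use `exp u ≤ 1 + u + u ^ 2` for `|u| ≤ 1`; the linear terms cancel because the variable is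
centred. -/
lemma two_point_exp_le {p t : ℝ} (hp : 0 ≤ p) (hp' : p ≤ 1) (ht : |t| ≤ 1) :
    p * Real.exp (t * (1 - p)) + (1 - p) * Real.exp (t * (0 - p)) ≤ Real.exp (t ^ 2) := by
  have key : ∀ y, |y| ≤ 1 → Real.exp (t * y) ≤ 1 + t * y + t ^ 2 := by
    intro y hy
    have h1 : |t * y| ≤ 1 := by
      rw [abs_mul]; exact mul_le_one₀ ht (abs_nonneg _) hy
    have h2 := (abs_le.1 (Real.abs_exp_sub_one_sub_id_le h1)).2
    have h3 : (t * y) ^ 2 ≤ t ^ 2 := by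
      rw [mul_pow]
      exact mul_le_of_le_one_right (sq_nonneg t) ((sq_le_one_iff_abs_le_one y).2 hy)
    linarith
  have h1 := mul_le_mul_of_nonneg_left (key (1 - p) (abs_le.2 ⟨by linarith, by linarith⟩)) hp
  have h2 := mul_le_mul_of_nonneg_left (key (0 - p) (abs_le.2 ⟨by linarith, by linarith⟩))
    (sub_nonneg.2 hp')
  have h3 := Real.add_one_le_exp (t ^ 2)
  nlinarith

lemma mgf_changes_le {n q b : ℕ} (hq : 1 ≤ q) (hb : 1 ≤ b) {t : ℝ} (ht : |t| ≤ 1) :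
    mgf (fun x : Fin n → Fin q => (changes b x : ℝ) - (n - b : ℕ) * (1 - (q : ℝ)⁻¹))
      (uniformWord n q) t ≤ Real.exp (n * t ^ 2) := by
  classical
  set p : ℝ := 1 - (q : ℝ)⁻¹ with hp
  have hq1 : (1 : ℝ) ≤ q := by exact_mod_cast hq
  have hq0 : (q : ℝ) ≠ 0 := by positivity
  have hinv : (q : ℝ)⁻¹ ≤ 1 := inv_le_one_of_one_le₀ hq1
  have hinv0 : 0 ≤ (q : ℝ)⁻¹ := by positivity
  have h := integral_prod_letter (n := n) hq hb
    (fun _ u v => if u ≠ v then Real.exp (t * (1 - p)) else Real.exp (t * (0 - p)))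
    (fun _ => p * Real.exp (t * (1 - p)) + (1 - p) * Real.exp (t * (0 - p))) (by
      intro i c
      rw [sum_ite_ne_some hq, hp]
      field_simp
      ring)
  have h' : mgf (fun x : Fin n → Fin q => (changes b x : ℝ) - (n - b : ℕ) * p)
      (uniformWord n q) t = (p * Real.exp (t * (1 - p)) + (1 - p) * Real.exp (t * (0 - p)))
        ^ (n - b) := by
    rw [Finset.prod_const, Finset.card_range] at h
    rw [← h, mgf]
    refine integral_congr_ae (Filter.Eventually.of_forall fun x => ?_)
    simp only
    have : t * ((changes b x : ℝ) - (n - b : ℕ) * p) = ∑ i ∈ Finset.range (n - b),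
        t * ((if letter x i ≠ letter x (i + b) then (1 : ℝ) else 0) - p) := by
      rw [← Finset.mul_sum, Finset.sum_sub_distrib, changes]
      push_cast
      simp
    rw [this, Real.exp_sum]
    refine Finset.prod_congr rfl fun i _ => ?_
    split_ifs <;> rfl
  rw [h']
  have h1 : 0 ≤ p * Real.exp (t * (1 - p)) + (1 - p) * Real.exp (t * (0 - p)) := by
    have : 0 ≤ p := by linarith
    have : 0 ≤ 1 - p := by linarith
    positivity
  calc _ ≤ Real.exp (t ^ 2) ^ (n - b) :=
        pow_le_pow_left₀ h1 (two_point_exp_le (by linarith) (by linarith) ht) _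
    _ ≤ Real.exp (t ^ 2) ^ n :=
        pow_le_pow_right₀ (Real.one_le_exp (sq_nonneg t)) (Nat.sub_le _ _)
    _ = Real.exp (n * t ^ 2) := by rw [← Real.exp_nat_mul]

/-- Chernoff bound for the number of letters that differ from the letter `b` places later. -/
lemma measureReal_changes_deviation_le {n q b : ℕ} (hq : 1 ≤ q) (hb : 1 ≤ b) (hn : 1 ≤ n) :
    (uniformWord n q).real {x | 2 * Real.sqrt (n * Real.log n) ≤
      |(changes b x : ℝ) - (n - b : ℕ) * (1 - (q : ℝ)⁻¹)|} ≤ 2 / n := by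
  have := isProbabilityMeasure_uniformWord n hq
  set X : (Fin n → Fin q) → ℝ :=
    fun x => (changes b x : ℝ) - (n - b : ℕ) * (1 - (q : ℝ)⁻¹) with hX
  have hn0 : (0 : ℝ) < n := by exact_mod_cast hn
  have hlog : 0 ≤ Real.log n := Real.log_natCast_nonneg n
  -- With this `t` the moment bound is `exp (log n)` and the Chernoff factor `exp (-(2 * log n))`,
  -- so each tail is at most `1 / n`.
  set t : ℝ := Real.sqrt (Real.log n / n) with ht
  have ht0 : 0 ≤ t := Real.sqrt_nonneg _
  have ht1 : t ≤ 1 := by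
    rw [ht, Real.sqrt_le_iff, and_iff_right zero_le_one, one_pow, div_le_one hn0]
    exact (Real.log_le_sub_one_of_pos hn0).trans (by linarith)
  have ht2 : (n : ℝ) * t ^ 2 = Real.log n := by
    rw [ht, Real.sq_sqrt (by positivity)]; field_simp
  have hts : t * Real.sqrt (n * Real.log n) = Real.log n := by
    rw [ht, ← Real.sqrt_mul (by positivity),
      show Real.log n / n * (n * Real.log n) = Real.log n ^ 2 by field_simp,
      Real.sqrt_sq hlog]
  have hexp : Real.exp (-(2 * Real.log n)) * Real.exp (n * t ^ 2) = 1 / n := by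
    rw [ht2, ← Real.exp_add, show -(2 * Real.log n) + Real.log n = -Real.log n by ring,
      Real.exp_neg, Real.exp_log hn0, one_div]
  have h1 : (uniformWord n q).real {x | 2 * Real.sqrt (n * Real.log n) ≤ X x} ≤ 1 / n := by
    refine (measure_ge_le_exp_mul_mgf _ ht0 .of_finite).trans ?_
    rw [← hexp, show -t * (2 * Real.sqrt (n * Real.log n)) = -(2 * Real.log n) by
      linarith]
    exact mul_le_mul_of_nonneg_left (mgf_changes_le hq hb (by rwa [abs_of_nonneg ht0]))
      (Real.exp_nonneg _)
  have h2 : (uniformWord n q).real {x | X x ≤ -(2 * Real.sqrt (n * Real.log n))} ≤ 1 / n := by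
    refine (measure_le_le_exp_mul_mgf _ (neg_nonpos.2 ht0) .of_finite).trans ?_
    rw [← hexp, show -(-t) * -(2 * Real.sqrt (n * Real.log n)) = -(2 * Real.log n) by
      linarith]
    refine mul_le_mul_of_nonneg_left ?_ (Real.exp_nonneg _)
    rw [← neg_sq t]
    exact mgf_changes_le hq hb (by rwa [abs_neg, abs_of_nonneg ht0])
  have hsub : {x | 2 * Real.sqrt (n * Real.log n) ≤ |X x|} ⊆
      {x | 2 * Real.sqrt (n * Real.log n) ≤ X x} ∪
      {x | X x ≤ -(2 * Real.sqrt (n * Real.log n))} := by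
    intro x (hx : _ ≤ |X x|)
    rcases le_abs'.1 hx with h | h
    · exact Or.inr h
    · exact Or.inl h
  refine (measureReal_mono hsub).trans ((measureReal_union_le _ _).trans ?_)
  calc _ ≤ 1 / (n : ℝ) + 1 / n := add_le_add h1 h2
    _ = 2 / n := by ring

/-! ### Distance of the ball size and its mean from the main term -/

lemma changes_le {α : Type*} {n b : ℕ} (x : Fin n → α) : changes b x ≤ n - b := by
  classical
  refine (Finset.sum_le_card_nsmul _ _ 1 fun i _ => ?_).trans (by simp)
  split_ifs <;> simp

lemma weight_le (q b : ℕ) (hb : 1 ≤ b) : (q - 1) * q ^ (b - 1) ≤ q ^ b :=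
  (Nat.mul_le_mul_right _ (Nat.sub_le _ _)).trans (mul_pow_sub_one (by omega) q).le

/-- The leading term of the size of the ball. -/
noncomputable def mainTerm {n q : ℕ} (b : ℕ) (x : Fin n → Fin q) : ℝ :=
  ((q - 1) * q ^ (b - 1) * (n - b + 1) : ℕ) * (changes b x : ℝ)

lemma mainTerm_coeff_le {n q b : ℕ} (hb : 1 ≤ b) (hn : b ≤ n) :
    (((q - 1) * q ^ (b - 1) * (n - b + 1) : ℕ) : ℝ) ≤ n * (q : ℝ) ^ b := by
  rw [mul_comm (n : ℝ)]
  exact_mod_cast Nat.mul_le_mul (weight_le q b hb) (by omega)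

lemma ballSize_le {n q b : ℕ} (hb : 1 ≤ b) (hn : b ≤ n) (x : Fin n → Fin q) :
    ballSize b x ≤ mainTerm b x + n * (q : ℝ) ^ b := by
  have := ncard_levenshteinBall_le hb hn x
  rw [← mul_assoc] at this
  rw [ballSize, mainTerm]
  exact_mod_cast this

lemma abs_ballSize_sub_mainTerm_le_of_not_run {n q b ℓ : ℕ} (hb : 1 ≤ b) (hn : b ≤ n)
    (x : Fin n → Fin q) (hx : ¬ HasPeriodicRun (2 * b) ℓ x) :
    |ballSize b x - mainTerm b x| ≤ n * (b + ℓ) * (q : ℝ) ^ b := by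
  have h1 := ballSize_le hb hn x
  have h2 := le_ncard_levenshteinBall hb hn x hx
  rw [← mul_assoc] at h2
  have h2' : mainTerm b x ≤ ballSize b x + n * (b + ℓ) * (q : ℝ) ^ b := by
    rw [ballSize, mainTerm]
    exact_mod_cast h2
  have h3 : (n : ℝ) * q ^ b ≤ n * (b + ℓ) * (q : ℝ) ^ b := by
    have : (1 : ℝ) ≤ b + ℓ := by exact_mod_cast (by omega : 1 ≤ b + ℓ)
    have h4 : (0 : ℝ) ≤ n * q ^ b := by positivity
    nlinarith
  rw [abs_le]
  constructor <;> linarith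

/-- This crude bound serves on the run event: weighted by probability `1 / n`, it adds only `n * q ^
b` to the error of the mean. -/
lemma abs_ballSize_sub_mainTerm_le {n q b : ℕ} (hb : 1 ≤ b) (hn : b ≤ n) (h1n : 1 ≤ n)
    (x : Fin n → Fin q) : |ballSize b x - mainTerm b x| ≤ n ^ 2 * (q : ℝ) ^ b := by
  have h1 := ballSize_le hb hn x
  have h2 : mainTerm b x ≤ n ^ 2 * (q : ℝ) ^ b := by
    have h3 : (changes b x : ℝ) ≤ n := by
      exact_mod_cast (changes_le x).trans (Nat.sub_le n b)
    calc mainTerm b x ≤ (n * (q : ℝ) ^ b) * n :=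
          mul_le_mul (mainTerm_coeff_le hb hn) h3 (by positivity) (by positivity)
      _ = _ := by ring
  have h3 : (n : ℝ) * q ^ b ≤ n ^ 2 * (q : ℝ) ^ b := by
    have : (1 : ℝ) ≤ n := by exact_mod_cast h1n
    have h4 : (0 : ℝ) ≤ n * q ^ b := by positivity
    nlinarith
  have h4 : 0 ≤ ballSize b x := Nat.cast_nonneg _
  rw [abs_le]
  constructor <;> linarith

lemma abs_integral_ballSize_sub_le {n q b ℓ : ℕ} (hq : 1 ≤ q) (hb : 1 ≤ b) (hn : b ≤ n)
    (hrun : (uniformWord n q).real {x | HasPeriodicRun (2 * b) ℓ x} ≤ 1 / n) :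
    |∫ x, ballSize b x ∂uniformWord n q - ((q - 1) * q ^ (b - 1) * (n - b + 1) : ℕ) *
      ((n - b : ℕ) * (1 - (q : ℝ)⁻¹))| ≤ n * (b + ℓ + 1) * (q : ℝ) ^ b := by
  classical
  have := isProbabilityMeasure_uniformWord n hq
  have hn0 : (0 : ℝ) < n := by exact_mod_cast (by omega : 0 < n)
  rw [← integral_changes hq hb, ← integral_const_mul, ← integral_sub .of_finite .of_finite]
  refine abs_integral_le_integral_abs.trans ?_
  calc ∫ x, |ballSize b x - mainTerm b x| ∂uniformWord n q
      ≤ ∫ x, (n * (b + ℓ) * (q : ℝ) ^ b + n ^ 2 * (q : ℝ) ^ b *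
          (if x ∈ {x | HasPeriodicRun (2 * b) ℓ x} then 1 else 0)) ∂uniformWord n q := by
        refine integral_mono .of_finite .of_finite fun x => ?_
        simp only
        split_ifs with hx
        · have h1 := abs_ballSize_sub_mainTerm_le hb hn (by omega) x
          have : 0 ≤ n * (b + ℓ) * (q : ℝ) ^ b := by positivity
          linarith
        · have := abs_ballSize_sub_mainTerm_le_of_not_run hb hn x hx
          linarith
    _ = n * (b + ℓ) * (q : ℝ) ^ b + n ^ 2 * (q : ℝ) ^ b *
          (uniformWord n q).real {x | HasPeriodicRun (2 * b) ℓ x} := by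
        rw [integral_add .of_finite .of_finite, integral_const, integral_const_mul,
          ← measureReal_uniformWord hq, probReal_univ, one_smul]
    _ ≤ n * (b + ℓ) * (q : ℝ) ^ b + n ^ 2 * (q : ℝ) ^ b * (1 / n) := by gcongr
    _ = n * (b + ℓ + 1) * (q : ℝ) ^ b := by field_simp

/-- The factor `2` makes a run at a given place have probability at most `n⁻²`, which absorbs the
union bound over `n` places. -/
lemma measureReal_hasPeriodicRun_le_inv {n q d : ℕ} (hq : 2 ≤ q) (hd : 1 ≤ d) (hn : 1 ≤ n) :
    (uniformWord n q).real {x | HasPeriodicRun d ⌈2 * Real.logb q n⌉₊ x} ≤ 1 / n := by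
  have hn0 : (0 : ℝ) < n := by exact_mod_cast hn
  have hq1 : (1 : ℝ) < q := by exact_mod_cast hq
  refine (measureReal_hasPeriodicRun_le (by omega) hd).trans ?_
  have h : (n : ℝ) ^ 2 ≤ (q : ℝ) ^ ⌈2 * Real.logb q n⌉₊ := by
    calc (n : ℝ) ^ 2 = (q : ℝ) ^ (2 * Real.logb q n) := by
          rw [mul_comm, Real.rpow_mul (by linarith), Real.rpow_logb (by linarith) hq1.ne' hn0]
          norm_cast
      _ ≤ (q : ℝ) ^ (⌈2 * Real.logb q n⌉₊ : ℝ) :=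
          Real.rpow_le_rpow_of_exponent_le hq1.le (Nat.le_ceil _)
      _ = _ := Real.rpow_natCast _ _
  calc (n : ℝ) * ((q : ℝ)⁻¹) ^ ⌈2 * Real.logb q n⌉₊ ≤ n * ((n : ℝ) ^ 2)⁻¹ := by
        rw [inv_pow]; gcongr
    _ = 1 / n := by field_simp

end BurstLevenshtein

theorem theorem5 (b q : ℕ) (hb : 1 ≤ b) (hq : 2 ≤ q) :
    ∃ C : ℝ, 0 < C ∧ ∃ N : ℕ, ∀ n : ℕ, N ≤ n →
      (BurstLevenshtein.uniformWord n q).real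
        {x : Fin n → Fin q |
          |BurstLevenshtein.ballSize b x
              - ∫ y, BurstLevenshtein.ballSize b y ∂(BurstLevenshtein.uniformWord n q)|
            > C * Real.sqrt ((n : ℝ) ^ 3 * Real.logb (q : ℝ) (n : ℝ))}
        ≤ 3 / (n : ℝ) := by
  have hq1 : (1 : ℝ) < q := by exact_mod_cast hq
  -- The first summand absorbs the errors of the ball and of its mean: `2 * b + 2 * ℓ + 1 ≤ (2 * b +
  -- 7) * L`, as `ℓ ≤ 2 * L + 1` and `1 ≤ L` (from `q ≤ n`). The second is the Chernoff deviation,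
  -- with `log n = L * log q`.
  refine ⟨(q : ℝ) ^ b * (2 * b + 7) + 2 * (q : ℝ) ^ b * Real.sqrt (Real.log q), by positivity,
    max q b, fun n hn => ?_⟩
  have hqn : q ≤ n := (le_max_left _ _).trans hn
  have hbn : b ≤ n := (le_max_right _ _).trans hn
  have := BurstLevenshtein.isProbabilityMeasure_uniformWord n (q := q) (by omega)
  have hn0 : (0 : ℝ) < n := by exact_mod_cast (by omega : 0 < n)
  set L := Real.logb q n with hL
  set ℓ := ⌈2 * L⌉₊ with hℓ
  have hL1 : 1 ≤ L := by
    rw [hL, Real.le_logb_iff_rpow_le hq1 hn0, Real.rpow_one]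
    exact_mod_cast hqn
  have hLn : L ≤ n := by
    rw [hL, Real.logb_le_iff_le_rpow hq1 hn0, Real.rpow_natCast]
    exact_mod_cast (Nat.lt_pow_self (by omega)).le
  have hlog : Real.log n = L * Real.log q := by
    rw [hL, Real.logb, div_mul_cancel₀]
    exact (Real.log_pos hq1).ne'
  have hℓL : (ℓ : ℝ) ≤ 2 * L + 1 := (Nat.ceil_lt_add_one (by linarith)).le
  set W := Real.sqrt ((n : ℝ) ^ 3 * L) with hW
  -- Squared, this is `L ≤ n`; it makes the overlap error negligible against the fluctuations.
  have hnL : n * L ≤ W := by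
    apply Real.le_sqrt_of_sq_le
    nlinarith [mul_nonneg (mul_nonneg (sq_nonneg (n : ℝ)) (by linarith : 0 ≤ L))
      (sub_nonneg.2 hLn)]
  have hdev : n * Real.sqrt (n * Real.log n) = W * Real.sqrt (Real.log q) := by
    calc n * Real.sqrt (n * Real.log n) = Real.sqrt (n ^ 2) * Real.sqrt (n * Real.log n) := by
          rw [Real.sqrt_sq hn0.le]
      _ = _ := by
          rw [hW, ← Real.sqrt_mul (by positivity), ← Real.sqrt_mul (by positivity), hlog]
          congr 1; ring
  have hrun := BurstLevenshtein.measureReal_hasPeriodicRun_le_inv (n := n) (d := 2 * b) hq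
    (by omega) (by omega)
  rw [← hL, ← hℓ] at hrun
  have hmean := BurstLevenshtein.abs_integral_ballSize_sub_le (by omega) hb hbn hrun
  have hch := BurstLevenshtein.measureReal_changes_deviation_le (n := n) (q := q) (b := b)
    (by omega) hb (by omega)
  refine (measureReal_mono (s₂ := {x | BurstLevenshtein.HasPeriodicRun (2 * b) ℓ x} ∪
    {x | 2 * Real.sqrt (n * Real.log n) ≤
      |(BurstLevenshtein.changes b x : ℝ) - (n - b : ℕ) * (1 - (q : ℝ)⁻¹)|}) ?_ (measure_ne_top _ _)).trans
    ((measureReal_union_le _ _).trans ((add_le_add hrun hch).trans_eq (by ring)))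
  intro x hx
  by_contra hc
  simp only [Set.mem_union, Set.mem_ofPred_eq, not_or, not_le] at hc hx
  obtain ⟨hc1, hc2⟩ := hc
  have h1 := BurstLevenshtein.abs_ballSize_sub_mainTerm_le_of_not_run hb hbn x hc1
  have hK := BurstLevenshtein.mainTerm_coeff_le (q := q) hb hbn
  rw [BurstLevenshtein.mainTerm] at h1
  set K : ℝ := (((q - 1) * q ^ (b - 1) * (n - b + 1) : ℕ) : ℝ)
  have hK0 : 0 ≤ K := Nat.cast_nonneg _
  set I := ∫ y, BurstLevenshtein.ballSize b y ∂BurstLevenshtein.uniformWord n q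
  set f := BurstLevenshtein.ballSize b x
  set R : ℝ := (BurstLevenshtein.changes b x : ℝ)
  set r : ℝ := (n - b : ℕ) * (1 - (q : ℝ)⁻¹)
  have h2 : |K * R - K * r| ≤ (n * (q : ℝ) ^ b) * (2 * Real.sqrt (n * Real.log n)) := by
    rw [← mul_sub, abs_mul, abs_of_nonneg hK0]
    exact mul_le_mul hK hc2.le (abs_nonneg _) (by positivity)
  have h3 : |f - I| ≤ |f - K * R| + |K * R - K * r| + |I - K * r| := by
    rw [abs_sub_comm I]
    calc |f - I| = |(f - K * R) + (K * R - K * r) + (K * r - I)| := by congr 1; ring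
      _ ≤ _ := abs_add_three _ _ _
  have h4 : n * ((b : ℝ) + ℓ) * (q : ℝ) ^ b + n * (b + ℓ + 1) * (q : ℝ) ^ b ≤
      (q : ℝ) ^ b * (2 * b + 7) * W := by
    calc _ = n * (2 * b + 2 * ℓ + 1) * (q : ℝ) ^ b := by ring
      _ ≤ n * ((2 * b + 7) * L) * (q : ℝ) ^ b := by
          gcongr
          nlinarith [(Nat.cast_nonneg b : (0 : ℝ) ≤ b)]
      _ = (q : ℝ) ^ b * (2 * b + 7) * (n * L) := by ring
      _ ≤ _ := by gcongr
  have h5 : (n * (q : ℝ) ^ b) * (2 * Real.sqrt (n * Real.log n)) =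
      2 * (q : ℝ) ^ b * Real.sqrt (Real.log q) * W := by
    calc _ = 2 * (q : ℝ) ^ b * (n * Real.sqrt (n * Real.log n)) := by ring
      _ = _ := by rw [hdev]; ring
  have h6 := hx.lt
  rw [add_mul] at h6
  linarith
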